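/- Let $G$ be a finite group, let $\ell$ be a prime dividing $|G|$, and suppose that $G$ is $\ell$-perfect, i.e. has no quotient isomorphic to $\mathbb Z/\ell$. Let $\mathbf C=(C_1,\dots,C_r)$ be conjugacy classes of $G$ (repetitions allowed) whose elements have order prime to $\ell$. A continuous epimorphism $\psi:A\to G$ from a profinite group is an $\ell$-Frattini cover if $\ker\psi$ is pro-$\ell$ and no proper closed subgroup of $A$ maps onto $G$. Let ${}_\ell\tilde\psi:{}_\ell\tilde G\to G$ be the universal $\ell$-Frattini cover, that is, an $\ell$-Frattini cover through which every finite $\ell$-Frattini cover of $G$ factors, and let ${}_\ell\tilde G_{\rm ab}={}_\ell\tilde G/\overline{[\ker{}_\ell\tilde\psi,\ker{}_\ell\tilde\psi]}\to G$ be its abelianization. Put $\ker_0=\ker({}_\ell\tilde G_{\rm ab}\to G)$, let $\ker_{k+1}$ be the closed subgroup generated by the $\ell$-th powers and the commutators of elements of $\ker_k$, and let $G_k={}_\ell\tilde G_{\rm ab}/\ker_k$ for $k\ge 0$ (so $G_0=G$). The Nielsen class $\mathrm{Ni}(G_k,\mathbf C)$ is the set of $\mathbf g=(g_1,\dots,g_r)\in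 G_k^r$ such that $\langle g_1,\dots,g_r\rangle=G_k$, $g_1g_2\cdots g_r=1$, and, for some permutation $\sigma$ of $\{1,\dots,r\}$, each $g_i$ maps into $C_{\sigma(i)}$ under $G_k\to G$ and has the same order as its image in $G$. Let $\mathrm{Ni}(G_k,\mathbf C)^{\rm in}$ be its quotient by simultaneous conjugation by $G_k$. The Hurwitz monodromy group $H_r$ acts on $\mathrm{Ni}(G_k,\mathbf C)^{\rm in}$ through $$q_i:(g_1,\dots,g_r)\mapsto(g_1,\dots,g_{i-1},\,g_ig_{i+1}g_i^{-1},\,g_i,\,g_{i+2},\dots,g_r)\quad(1\le i\le r-1),\qquad \mathbf{sh}:(g_1,\dots,g_r)\mapsto(g_2,\dots,g_r,g_1);$$ its orbits are called braid orbits. The level $k$ Hurwitz space $\mathcal H(G_k,\mathbf C)^{\rm in}$ is the covering, defined by this action, of the space of $r$-element subsets of $\mathbb P^1(\mathbb C)$; its fibre is $\mathrm{Ni}(G_k,\mathbf C)^{\rm in}$, so it is nonempty exactly when $\mathrm{Ni}(G_k,\mathbf C)^{\rm in}$ is, and its components correspond to the braid orbits. A Modular Tower is a sequence $(O_k)_{k\ge0}$,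 with $O_k$ a braid orbit on $\mathrm{Ni}(G_k,\mathbf C)^{\rm in}$, such that for every $k\ge 0$ the map induced by $G_{k+1}\to G_k$ maps $O_{k+1}$ onto $O_k$. **Lemma.** If $\mathrm{Ni}(G_k,\mathbf C)^{\rm in}$ is nonempty for every $k\ge0$ (every level of the Hurwitz space tower of ${}_\ell\tilde G_{\rm ab}$ is nonempty), then there is at least one Modular Tower $(O_k)_{k\ge 0}$. -/

import Mathlib

namespace ModularTower

/-! ### Frattini covers of a finite group -/

section Frattini

variable {A G : Type*} [Group A] [TopologicalSpace A] [Group G] [TopologicalSpace G]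

/-- A continuous homomorphism `ψ : A → G` is an `ℓ`-Frattini cover if it is onto, no proper closed
subgroup of `A` maps onto `G`, and its kernel is pro-`ℓ` (its image in `A / U` is an `ℓ`-group for
each open normal subgroup `U`). For finite discrete `A` the words "closed" and "pro" are void. -/
structure IsLFrattiniCover (ℓ : ℕ) (ψ : A →ₜ* G) : Prop where
  surjective : Function.Surjective ψ
  frattini : ∀ S : Subgroup A, IsClosed (S : Set A) → S.map ψ.toMonoidHom = ⊤ → S = ⊤
  proL : ∀ U : OpenNormalSubgroup A,
    IsPGroup ℓ (ψ.toMonoidHom.ker.map (QuotientGroup.mk' U.toSubgroup))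

/-- A universal `ℓ`-Frattini cover of `G`: an `ℓ`-Frattini cover `ψ : A → G` through which every
finite `ℓ`-Frattini cover of `G` factors (hence, by compactness, every profinite one). It is used
for profinite groups `A` and finite discrete groups `G`. -/
structure IsUniversalLFrattiniCover (ℓ : ℕ) (ψ : A →ₜ* G) : Prop
    extends IsLFrattiniCover ℓ ψ where
  universal : ∀ (H : Type) [Group H] [Finite H] [TopologicalSpace H] [DiscreteTopology H]
    (φ : H →ₜ* G), IsLFrattiniCover ℓ φ → ∃ f : A →ₜ* H, φ.comp f = ψ

/-- `G` is `ℓ`-perfect: it has no quotient `ℤ/ℓ`. -/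
def IsLPerfect (ℓ : ℕ) (G : Type*) [Group G] : Prop :=
  ¬ ∃ f : G →* Multiplicative (ZMod ℓ), Function.Surjective f

end Frattini

/-! ### Existence of the universal `ℓ`-Frattini cover -/

section Existence

universe u

theorem exists_minimal_closed {P G : Type*} [Group P] [TopologicalSpace P] [CompactSpace P]
    [Group G] [TopologicalSpace G] [T1Space G] (p : P →* G) (hp : Continuous p) (E : Subgroup P)
    (hE : IsClosed (E : Set P)) (hEp : E.map p = ⊤) :
    ∃ D ≤ E, IsClosed (D : Set P) ∧ D.map p = ⊤ ∧
      ∀ D' ≤ D, IsClosed (D' : Set P) → D'.map p = ⊤ → D' = D := by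
  let T := {D : Subgroup P // D ≤ E ∧ IsClosed (D : Set P) ∧ D.map p = ⊤}
  have : Nonempty T := ⟨⟨E, le_rfl, hE, hEp⟩⟩
  obtain ⟨D, hD⟩ := exists_maximal_of_nonempty_chains_bounded (α := T)
    (r := fun a b => b.1 ≤ a.1) (fun c hchain hcne => by
      have : Nonempty c := hcne.to_subtype
      obtain ⟨y, hy⟩ := hcne
      refine ⟨⟨⨅ s : c, s.1.1, (iInf_le _ (⟨y, hy⟩ : c)).trans y.2.1, ?_, ?_⟩,
        fun z hz => iInf_le (fun s : c => s.1.1) ⟨z, hz⟩⟩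
      · rw [Subgroup.coe_iInf]
        exact isClosed_iInter fun s => s.1.2.2.1
      · rw [eq_top_iff]
        intro x _
        have hne : (⋂ s : c, (s.1.1 : Set P) ∩ p ⁻¹' {x}).Nonempty := by
          have hcl : ∀ s : c, IsClosed ((s.1.1 : Set P) ∩ p ⁻¹' {x}) := fun s =>
            s.1.2.2.1.inter (isClosed_singleton.preimage hp)
          refine IsCompact.nonempty_iInter_of_directed_nonempty_isCompact_isClosed _ ?_ ?_
            (fun s => (hcl s).isCompact) hcl
          · intro s t
            by_cases hst : s = t
            · exact ⟨s, subset_rfl, by rw [hst]⟩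
            rcases hchain s.2 t.2 (fun h => hst (Subtype.ext h)) with h | h
            · exact ⟨t, Set.inter_subset_inter_left _ h, subset_rfl⟩
            · exact ⟨s, subset_rfl, Set.inter_subset_inter_left _ h⟩
          · intro s
            have : x ∈ s.1.1.map p := s.1.2.2.2.ge (Subgroup.mem_top x)
            obtain ⟨a, ha, hax⟩ := this
            exact ⟨a, ha, hax⟩
        obtain ⟨a, ha⟩ := hne
        rw [Set.mem_iInter] at ha
        refine ⟨a, ?_, (ha ⟨y, hy⟩).2⟩
        rw [Subgroup.coe_iInf]
        exact Set.mem_iInter.2 fun s => (ha s).1) (fun h1 h2 => h2.trans h1)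
  exact ⟨D.1, D.2.1, D.2.2.1, D.2.2.2, fun D' hle h1 h2 =>
    le_antisymm hle (hD ⟨D', hle.trans D.2.1, h1, h2⟩ hle)⟩

/-- Every finite group has a universal `ℓ`-Frattini cover: a minimal closed subgroup that maps onto
`G` in the completion of the free group on `G` with respect to the normal subgroups of finite index
that have `ℓ`-power index in the kernel of the map onto `G`. -/
theorem exists_isUniversalLFrattiniCover (G : Type u) [Group G] [Finite G] [TopologicalSpace G]
    [DiscreteTopology G] (ℓ : ℕ) :
    ∃ (A : Type u) (_ : Group A) (_ : TopologicalSpace A) (_ : IsTopologicalGroup A)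
      (_ : CompactSpace A) (_ : T2Space A) (_ : TotallyDisconnectedSpace A) (ψ : A →ₜ* G),
      IsUniversalLFrattiniCover ℓ ψ := by
  let π : FreeGroup G →* G := FreeGroup.lift id
  have hπ : Function.Surjective π := fun x => ⟨FreeGroup.of x, by simp [π]⟩
  let I : Type u := {N : Subgroup (FreeGroup G) // N.Normal ∧ Finite (FreeGroup G ⧸ N) ∧
    N ≤ π.ker ∧ ∀ x ∈ π.ker, ∃ n : ℕ, x ^ ℓ ^ n ∈ N}
  have hnorm : ∀ i : I, i.1.Normal := fun i => i.2.1
  have hfin : ∀ i : I, Finite (FreeGroup G ⧸ i.1) := fun i => i.2.2.1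
  let _ : ∀ i : I, TopologicalSpace (FreeGroup G ⧸ i.1) := fun _ => ⊥
  have : ∀ i : I, DiscreteTopology (FreeGroup G ⧸ i.1) := fun _ => ⟨rfl⟩
  let i₀ : I := ⟨π.ker, inferInstance,
    Finite.of_injective _ (QuotientGroup.kerLift_injective π), le_rfl,
    fun x hx => ⟨0, by simpa using hx⟩⟩
  let P : Type u := ∀ i : I, FreeGroup G ⧸ i.1
  let ι : FreeGroup G →* P := MonoidHom.pi fun i => QuotientGroup.mk' i.1
  let p : P →* G := (QuotientGroup.kerLift π).comp (Pi.evalMonoidHom _ i₀)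
  have hp : Continuous p :=
    (continuous_of_discreteTopology (α := FreeGroup G ⧸ i₀.1)
      (f := QuotientGroup.kerLift π)).comp (continuous_apply i₀)
  have hpι : ∀ x, p (ι x) = π x := fun x => rfl
  let E : Subgroup P := ι.range.topologicalClosure
  have hE : IsClosed (E : Set P) := Subgroup.isClosed_topologicalClosure _
  have hEp : E.map p = ⊤ := by
    rw [eq_top_iff]
    intro x _
    obtain ⟨f, rfl⟩ := hπ x
    exact ⟨ι f, Subgroup.le_topologicalClosure _ ⟨f, rfl⟩, hpι f⟩
  -- elements of `E` agree with words at any two coordinates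
  have happrox : ∀ x ∈ E, ∀ i j : I, ∃ f : FreeGroup G, x i = ι f i ∧ x j = ι f j := by
    intro x hx i j
    have hx' : x ∈ closure (ι.range : Set P) := hx
    rw [mem_closure_iff] at hx'
    have hopen : ∀ i : I, IsOpen {y : P | y i = x i} := fun i =>
      (isOpen_discrete ({x i} : Set (FreeGroup G ⧸ i.1))).preimage
        (continuous_apply (A := fun i : I => FreeGroup G ⧸ i.1) i)
    obtain ⟨y, ⟨hy1, hy2⟩, f, rfl⟩ := hx' _ ((hopen i).inter (hopen j)) ⟨rfl, rfl⟩
    exact ⟨f, hy1.symm, hy2.symm⟩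
  obtain ⟨D, hDE, hDcl, hDp, hDmin⟩ := exists_minimal_closed p hp E hE hEp
  have : CompactSpace D := isCompact_iff_compactSpace.1 hDcl.isCompact
  let ψ : D →ₜ* G := ⟨p.comp D.subtype, hp.comp continuous_subtype_val⟩
  have htors : ∀ x ∈ E, p x = 1 → ∀ i : I, ∃ n : ℕ, x i ^ ℓ ^ n = 1 := by
    intro x hx hpx i
    obtain ⟨f, hf, hf0⟩ := happrox x hx i i₀
    have hfk : f ∈ π.ker := by
      rw [MonoidHom.mem_ker, ← hpι f, ← hpx]
      exact congrArg (QuotientGroup.kerLift π) hf0.symm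
    obtain ⟨n, hn⟩ := i.2.2.2.2 f hfk
    refine ⟨n, ?_⟩
    rw [hf]
    exact (QuotientGroup.eq_one_iff (N := i.1) _).2 hn
  refine ⟨D, inferInstance, inferInstance, inferInstance, inferInstance, inferInstance,
    inferInstance, ψ, ⟨⟨?_, ?_, ?_⟩, ?_⟩⟩
  · intro x
    have : x ∈ D.map p := hDp ▸ Subgroup.mem_top x
    obtain ⟨d, hd, rfl⟩ := this
    exact ⟨⟨d, hd⟩, rfl⟩
  · intro S hS hSt
    have h1 : IsClosed ((S.map D.subtype : Subgroup P) : Set P) := by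
      rw [Subgroup.coe_map]
      exact hDcl.isClosedEmbedding_subtypeVal.isClosedMap _ hS
    have h2 : (S.map D.subtype).map p = ⊤ := by
      rw [Subgroup.map_map]; exact hSt
    have h3 := hDmin _ (Subgroup.map_subtype_le S) h1 h2
    rw [eq_top_iff]
    intro x _
    have : (x : P) ∈ S.map D.subtype := h3.ge x.2
    obtain ⟨y, hy, hyx⟩ := this
    rwa [← Subtype.ext hyx]
  · rintro U ⟨_, x, hx, rfl⟩
    have hUo : IsOpen ((U.toSubgroup : Subgroup D) : Set D) := U.isOpen'
    obtain ⟨V, hVo, hVU⟩ := isOpen_induced_iff.1 hUo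
    have h1V : (1 : P) ∈ V := by
      have : (1 : D) ∈ (Subtype.val ⁻¹' V : Set D) := hVU ▸ U.toSubgroup.one_mem
      exact this
    obtain ⟨J, u, hu, huV⟩ := isOpen_pi_iff.1 hVo 1 h1V
    choose n hn using htors x.1 (hDE x.2) hx
    refine ⟨∑ j ∈ J, n j, ?_⟩
    have hmem : x ^ ℓ ^ (∑ j ∈ J, n j) ∈ (Subtype.val ⁻¹' V : Set D) := by
      refine huV fun j hj => ?_
      have : (x.1 ^ ℓ ^ (∑ j ∈ J, n j)) j = 1 := by
        obtain ⟨m, hm⟩ := Nat.exists_eq_add_of_le (Finset.single_le_sum (f := n)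
          (fun _ _ => Nat.zero_le _) hj)
        rw [hm, pow_add, Pi.pow_apply, pow_mul, hn j, one_pow]
      change (x.1 ^ ℓ ^ (∑ j ∈ J, n j)) j ∈ u j
      rw [this]
      exact (hu j hj).2
    rw [hVU] at hmem
    apply Subtype.ext
    exact (QuotientGroup.eq_one_iff (N := U.toSubgroup) _).2 hmem
  · intro H _ _ _ _ φ hφ
    choose s hs using hφ.surjective
    let f₀ : FreeGroup G →* H := FreeGroup.lift s
    have hf₀ : ∀ x, φ (f₀ x) = π x := by
      have : φ.toMonoidHom.comp f₀ = π := by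
        ext g
        simp [f₀, π, hs]
      exact fun x => DFunLike.congr_fun this x
    let i : I := ⟨f₀.ker, inferInstance,
      Finite.of_injective _ (QuotientGroup.kerLift_injective f₀), fun x hx => by
        rw [MonoidHom.mem_ker] at hx ⊢
        rw [← hf₀, hx, map_one], fun x hx => by
        have hx' : f₀ x ∈ φ.toMonoidHom.ker := by
          rw [MonoidHom.mem_ker] at hx ⊢
          exact (hf₀ x).trans hx
        let U : OpenNormalSubgroup H :=
          { toSubgroup := ⊥, isOpen' := isOpen_discrete _, isNormal' := inferInstance }
        obtain ⟨n, hn⟩ := hφ.proL U ⟨_, f₀ x, hx', rfl⟩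
        refine ⟨n, ?_⟩
        have h2 := congrArg Subtype.val hn
        have h3 : f₀ x ^ ℓ ^ n ∈ (⊥ : Subgroup H) :=
          (QuotientGroup.eq_one_iff (N := U.toSubgroup) _).1 h2
        rw [MonoidHom.mem_ker, map_pow]
        exact Subgroup.mem_bot.1 h3⟩
    let f : P →* H := (QuotientGroup.kerLift f₀).comp (Pi.evalMonoidHom _ i)
    have hf : Continuous f :=
      (continuous_of_discreteTopology (α := FreeGroup G ⧸ i.1)
        (f := QuotientGroup.kerLift f₀)).comp (continuous_apply i)
    refine ⟨⟨f.comp D.subtype, hf.comp continuous_subtype_val⟩, ?_⟩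
    ext x
    obtain ⟨w, hw, hw0⟩ := happrox x.1 (hDE x.2) i i₀
    have e1 : f x.1 = f₀ w := congrArg (QuotientGroup.kerLift f₀) hw
    have e2 : p x.1 = π w := congrArg (QuotientGroup.kerLift π) hw0
    change φ (f x.1) = p x.1
    rw [e1, e2, hf₀]

end Existence

/-! ### The abelianized cover, characteristic kernels and levels -/

section Levels

variable {A G : Type*} [Group A] [TopologicalSpace A] [IsTopologicalGroup A]
  [Group G] [TopologicalSpace G]

/-- The closed commutator subgroup of the kernel of `ψ`. -/
def kerCommutator (ψ : A →ₜ* G) : Subgroup A :=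
  ⁅ψ.toMonoidHom.ker, ψ.toMonoidHom.ker⁆.topologicalClosure

instance (ψ : A →ₜ* G) : (kerCommutator ψ).Normal :=
  Subgroup.is_normal_topologicalClosure _

theorem isClosed_ker {A G : Type*} [Group A] [TopologicalSpace A] [Group G] [TopologicalSpace G]
    [T1Space G] (ψ : A →ₜ* G) : IsClosed (ψ.toMonoidHom.ker : Set A) :=
  (isClosed_singleton (x := (1 : G))).preimage ψ.continuous_toFun

theorem kerCommutator_le [T1Space G] (ψ : A →ₜ* G) : kerCommutator ψ ≤ ψ.toMonoidHom.ker :=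
  Subgroup.topologicalClosure_minimal _ (Subgroup.commutator_le_right _ _) (isClosed_ker ψ)

/-- The abelianization `A / [ker ψ, ker ψ]` of a cover `ψ : A → G`. -/
abbrev AbCover (ψ : A →ₜ* G) : Type _ := A ⧸ kerCommutator ψ

/-- The map `A / [ker ψ, ker ψ] → G` induced by `ψ`. -/
def abCoverMap [T1Space G] (ψ : A →ₜ* G) : AbCover ψ →ₜ* G where
  toMonoidHom := QuotientGroup.lift (kerCommutator ψ) ψ.toMonoidHom (kerCommutator_le ψ)
  continuous_toFun := Continuous.quotient_lift ψ.continuous_toFun _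

/-- The `ℓ`-Frattini subgroup of `K`: the closed subgroup generated by the `ℓ`-th powers and the
commutators of elements of `K`. -/
def lFrattini (ℓ : ℕ) (K : Subgroup A) : Subgroup A :=
  (Subgroup.closure ((fun x => x ^ ℓ) '' (K : Set A)) ⊔ ⁅K, K⁆).topologicalClosure

instance (ℓ : ℕ) (K : Subgroup A) [hK : K.Normal] : (lFrattini ℓ K).Normal := by
  have : (Subgroup.closure ((fun x => x ^ ℓ) '' (K : Set A))).Normal := by
    refine ⟨fun n hn a => ?_⟩
    induction hn using Subgroup.closure_induction with
    | mem x hx =>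
      obtain ⟨y, hy, rfl⟩ := hx
      exact Subgroup.subset_closure ⟨a * y * a⁻¹, hK.conj_mem y hy a, by simp [conj_pow]⟩
    | one => simp
    | mul x y _ _ hx hy => simpa [mul_assoc] using mul_mem hx hy
    | inv x _ hx => simpa [mul_assoc] using inv_mem hx
  exact Subgroup.is_normal_topologicalClosure _

/-- The characteristic kernels of `ψ`: `ker_0 = ker ψ` and `ker_{k+1}` is the `ℓ`-Frattini
subgroup of `ker_k`. -/
def charKer (ℓ : ℕ) (ψ : A →ₜ* G) : ℕ → Subgroup A
  | 0 => ψ.toMonoidHom.ker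
  | k + 1 => lFrattini ℓ (charKer ℓ ψ k)

instance charKer_normal (ℓ : ℕ) (ψ : A →ₜ* G) : (k : ℕ) → (charKer ℓ ψ k).Normal
  | 0 => inferInstanceAs ψ.toMonoidHom.ker.Normal
  | k + 1 => by
    have := charKer_normal ℓ ψ k
    exact inferInstanceAs (lFrattini ℓ (charKer ℓ ψ k)).Normal

theorem isClosed_charKer [T1Space G] (ℓ : ℕ) (ψ : A →ₜ* G) :
    (k : ℕ) → IsClosed (charKer ℓ ψ k : Set A)
  | 0 => isClosed_ker ψ
  | _ + 1 => Subgroup.isClosed_topologicalClosure _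

theorem charKer_succ_le [T1Space G] (ℓ : ℕ) (ψ : A →ₜ* G) (k : ℕ) :
    charKer ℓ ψ (k + 1) ≤ charKer ℓ ψ k := by
  refine Subgroup.topologicalClosure_minimal _ (sup_le ?_ ?_) (isClosed_charKer ℓ ψ k)
  · rw [Subgroup.closure_le]
    rintro _ ⟨x, hx, rfl⟩
    exact pow_mem hx ℓ
  · exact Subgroup.commutator_le_right _ _

theorem charKer_le_ker [T1Space G] (ℓ : ℕ) (ψ : A →ₜ* G) (k : ℕ) :
    charKer ℓ ψ k ≤ ψ.toMonoidHom.ker := by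
  induction k with
  | zero => exact le_rfl
  | succ k ih => exact (charKer_succ_le ℓ ψ k).trans ih

/-- The level `k` group `A / ker_k` of the cover `ψ : A → G`; level `0` is a copy of `G`. -/
abbrev Level (ℓ : ℕ) (ψ : A →ₜ* G) (k : ℕ) : Type _ := A ⧸ charKer ℓ ψ k

/-- The natural map from level `k` to `G`. -/
def levelToBase [T1Space G] (ℓ : ℕ) (ψ : A →ₜ* G) (k : ℕ) : Level ℓ ψ k →* G :=
  QuotientGroup.lift (charKer ℓ ψ k) ψ.toMonoidHom (charKer_le_ker ℓ ψ k)

/-- The natural map from level `k + 1` to level `k`. -/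
def levelMap [T1Space G] (ℓ : ℕ) (ψ : A →ₜ* G) (k : ℕ) : Level ℓ ψ (k + 1) →* Level ℓ ψ k :=
  QuotientGroup.map _ _ (MonoidHom.id A) (charKer_succ_le ℓ ψ k)

theorem levelMap_surjective [T1Space G] (ℓ : ℕ) (ψ : A →ₜ* G) (k : ℕ) :
    Function.Surjective (levelMap ℓ ψ k) := by
  intro y
  obtain ⟨a, rfl⟩ := QuotientGroup.mk_surjective y
  exact ⟨QuotientGroup.mk a, rfl⟩

theorem levelToBase_comp_levelMap [T1Space G] (ℓ : ℕ) (ψ : A →ₜ* G) (k : ℕ) :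
    (levelToBase ℓ ψ k).comp (levelMap ℓ ψ k) = levelToBase ℓ ψ (k + 1) := by
  ext x
  rfl

end Levels

/-! ### Nielsen classes and the braid action -/

section Nielsen

variable {H H' G : Type*} [Group H] [Group H'] [Group G] {r : ℕ}

/-- The tuples `g ∈ H^r` that lie in the Nielsen class `Ni(H, C)`. Here `φ : H → G` is a cover and
`C` are `r` conjugacy classes of `G`, counted with multiplicity. Each class `C_i` is lifted to the
elements of `H` that lie over `C_i` and have the same order as their image in `G`; if the elements
of `C_i` have order prime to `ℓ` and `ker φ` is a finite `ℓ`-group, these form one conjugacy class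
of `H`. The entries of `g` lie in the lifted classes in some order, generate `H`, and have
product one. -/
structure IsNielsen (φ : H →* G) (C : Fin r → ConjClasses G) (g : Fin r → H) : Prop where
  mem_classes : ∃ σ : Equiv.Perm (Fin r), ∀ i,
    ConjClasses.mk (φ (g i)) = C (σ i) ∧ orderOf (g i) = orderOf (φ (g i))
  generates : Subgroup.closure (Set.range g) = ⊤
  prod_one : (List.ofFn g).prod = 1

/-- The Nielsen class `Ni(H, C)`. -/
abbrev Nielsen (φ : H →* G) (C : Fin r → ConjClasses G) : Type _ :=
  {g : Fin r → H // IsNielsen φ C g}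

/-- The braid generator `q` at the positions `i`, `j = i + 1`:
`(…, g_i, g_j, …) ↦ (…, g_i g_j g_i⁻¹, g_i, …)`. -/
def braidFun (i j : Fin r) (g : Fin r → H) : Fin r → H := fun k =>
  if k = i then g i * g j * (g i)⁻¹ else if k = j then g i else g k

/-- The inverse braid generator: `(…, g_i, g_j, …) ↦ (…, g_j, g_j⁻¹ g_i g_j, …)`. -/
def braidInvFun (i j : Fin r) (g : Fin r → H) : Fin r → H := fun k =>
  if k = i then g j else if k = j then (g j)⁻¹ * g i * g j else g k

/-- The braid generator as a permutation of `H^r`. -/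
def braidPerm {i j : Fin r} (hij : i ≠ j) : Equiv.Perm (Fin r → H) where
  toFun := braidFun i j
  invFun := braidInvFun i j
  left_inv g := by
    funext k
    by_cases hi : k = i
    · subst hi; simp [braidFun, braidInvFun, hij.symm]
    · by_cases hj : k = j
      · subst hj; simp [braidFun, braidInvFun, hij.symm, mul_assoc]
      · simp [braidFun, braidInvFun, hi, hj]
  right_inv g := by
    funext k
    by_cases hi : k = i
    · subst hi; simp [braidFun, braidInvFun, hij.symm, mul_assoc]
    · by_cases hj : k = j
      · subst hj; simp [braidFun, braidInvFun, hij.symm]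
      · simp [braidFun, braidInvFun, hi, hj]

theorem prod_braidFun : ∀ {r : ℕ} (i : ℕ) (hi : i + 1 < r) (g : Fin r → H),
    (List.ofFn (braidFun ⟨i, by omega⟩ ⟨i + 1, hi⟩ g)).prod = (List.ofFn g).prod
  | 0, _, hi, _ => by omega
  | 1, _, hi, _ => by omega
  | r + 2, 0, _, g => by
    rw [List.ofFn_succ, List.ofFn_succ, List.ofFn_succ (f := g),
      List.ofFn_succ (f := fun k : Fin (r + 1) => g k.succ)]
    simp [braidFun, Fin.ext_iff, mul_assoc]
  | r + 2, i + 1, hi, g => by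
    have := prod_braidFun i (by omega) (fun k : Fin (r + 1) => g k.succ)
    rw [List.ofFn_succ, List.prod_cons, List.ofFn_succ (f := g), List.prod_cons, ← this]
    simp [braidFun, Fin.ext_iff]

theorem exists_perm_iff_of_conj {φ : H →* G} {C : Fin r → ConjClasses G} {g g' : Fin r → H}
    (τ : Equiv.Perm (Fin r)) (h : ∀ k, ∃ a, g' k = a * g (τ k) * a⁻¹) :
    (∃ σ : Equiv.Perm (Fin r), ∀ i,
        ConjClasses.mk (φ (g i)) = C (σ i) ∧ orderOf (g i) = orderOf (φ (g i))) ↔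
      ∃ σ : Equiv.Perm (Fin r), ∀ i,
        ConjClasses.mk (φ (g' i)) = C (σ i) ∧ orderOf (g' i) = orderOf (φ (g' i)) := by
  have key : ∀ k, ConjClasses.mk (φ (g' k)) = ConjClasses.mk (φ (g (τ k))) ∧
      orderOf (g' k) = orderOf (g (τ k)) ∧ orderOf (φ (g' k)) = orderOf (φ (g (τ k))) := by
    intro k
    obtain ⟨a, ha⟩ := h k
    refine ⟨?_, ?_, ?_⟩
    · rw [ConjClasses.mk_eq_mk_iff_isConj, ha]
      exact (isConj_iff.2 ⟨φ a, by simp⟩).symm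
    · rw [ha]
      exact orderOf_injective (MulAut.conj a).toMonoidHom (MulAut.conj a).injective _
    · rw [ha, map_mul, map_mul, map_inv]
      exact orderOf_injective (MulAut.conj (φ a)).toMonoidHom (MulAut.conj (φ a)).injective _
  constructor
  · rintro ⟨σ, hσ⟩
    refine ⟨τ.trans σ, fun k => ?_⟩
    rw [(key k).1, (key k).2.1, (key k).2.2]
    exact hσ (τ k)
  · rintro ⟨σ, hσ⟩
    refine ⟨τ.symm.trans σ, fun k => ?_⟩
    have h1 := key (τ.symm k)
    rw [Equiv.apply_symm_apply] at h1
    rw [← h1.1, ← h1.2.1, ← h1.2.2]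
    exact hσ (τ.symm k)

theorem isNielsen_braidPerm {φ : H →* G} {C : Fin r → ConjClasses G} (i : ℕ) (hi : i + 1 < r)
    (g : Fin r → H) :
    IsNielsen φ C g ↔
      IsNielsen φ C (braidPerm (i := ⟨i, by omega⟩) (j := ⟨i + 1, hi⟩) (by simp) g) := by
  set p : Fin r := ⟨i, by omega⟩ with hp
  set q : Fin r := ⟨i + 1, hi⟩ with hq
  have hpq : p ≠ q := by simp [hp, hq]
  set g' := braidPerm (H := H) hpq g with hg'
  have h1 : g' p = g p * g q * (g p)⁻¹ := by simp [hg', braidPerm, braidFun]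
  have h2 : g' q = g p := by simp [hg', braidPerm, braidFun, hpq.symm]
  have h3 : ∀ k, k ≠ p → k ≠ q → g' k = g k := fun k hk hk' => by
    simp [hg', braidPerm, braidFun, hk, hk']
  have hconj : ∀ k, ∃ a, g' k = a * g (Equiv.swap p q k) * a⁻¹ := by
    intro k
    by_cases hkp : k = p
    · exact ⟨g p, by rw [hkp, h1, Equiv.swap_apply_left]⟩
    · by_cases hkq : k = q
      · subst hkq; exact ⟨1, by rw [h2, Equiv.swap_apply_right]; simp⟩
      · exact ⟨1, by rw [h3 k hkp hkq, Equiv.swap_apply_of_ne_of_ne hkp hkq]; simp⟩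
  have hcl : Subgroup.closure (Set.range g') = Subgroup.closure (Set.range g) := by
    have hm : ∀ k, g k ∈ Subgroup.closure (Set.range g) := fun k =>
      Subgroup.subset_closure ⟨k, rfl⟩
    have hm' : ∀ k, g' k ∈ Subgroup.closure (Set.range g') := fun k =>
      Subgroup.subset_closure ⟨k, rfl⟩
    apply le_antisymm
    · rw [Subgroup.closure_le]
      rintro _ ⟨k, rfl⟩
      by_cases hkp : k = p
      · subst hkp; rw [h1]; exact mul_mem (mul_mem (hm _) (hm _)) (inv_mem (hm _))
      · by_cases hkq : k = q
        · subst hkq; rw [h2]; exact hm _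
        · rw [h3 k hkp hkq]; exact hm _
    · rw [Subgroup.closure_le]
      rintro _ ⟨k, rfl⟩
      by_cases hkp : k = p
      · subst hkp; rw [← h2]; exact hm' _
      · by_cases hkq : k = q
        · have : g k = (g' q)⁻¹ * g' p * g' q := by rw [hkq, h1, h2]; group
          rw [this]; exact mul_mem (mul_mem (inv_mem (hm' _)) (hm' _)) (hm' _)
        · rw [← h3 k hkp hkq]; exact hm' _
  have hprod : (List.ofFn g').prod = (List.ofFn g).prod := prod_braidFun i hi g
  constructor
  · rintro ⟨a, b, c⟩
    exact ⟨(exists_perm_iff_of_conj _ hconj).1 a, hcl.trans b, hprod.trans c⟩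
  · rintro ⟨a, b, c⟩
    exact ⟨(exists_perm_iff_of_conj _ hconj).2 a, hcl.symm.trans b, hprod.symm.trans c⟩

/-- The shift `(g_1, …, g_r) ↦ (g_2, …, g_r, g_1)` as a permutation of `H^r`. -/
def shiftPerm : Equiv.Perm (Fin r → H) where
  toFun g := g ∘ finRotate r
  invFun g := g ∘ (finRotate r).symm
  left_inv g := by
    funext k
    exact congrArg g ((finRotate r).apply_symm_apply k)
  right_inv g := by
    funext k
    exact congrArg g ((finRotate r).symm_apply_apply k)

theorem prod_shiftPerm (g : Fin r → H) :
    (List.ofFn (shiftPerm g)).prod = 1 ↔ (List.ofFn g).prod = 1 := by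
  cases r with
  | zero => simp
  | succ n =>
    have h : ∀ k : Fin n, finRotate (n + 1) k.castSucc = k.succ := fun k => by
      rw [finRotate_apply, Fin.coeSucc_eq_succ]
    rw [List.ofFn_succ', List.ofFn_succ (f := g), List.concat_eq_append, List.prod_append,
      List.prod_cons, mul_eq_one_comm]
    simp [shiftPerm, h]

theorem isNielsen_shiftPerm {φ : H →* G} {C : Fin r → ConjClasses G} (g : Fin r → H) :
    IsNielsen φ C g ↔ IsNielsen φ C (shiftPerm g) := by
  have hconj : ∀ k, ∃ a, shiftPerm g k = a * g (finRotate r k) * a⁻¹ := fun k =>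
    ⟨1, by simp [shiftPerm]⟩
  have hr : Set.range (shiftPerm g) = Set.range g := (finRotate r).surjective.range_comp g
  constructor
  · rintro ⟨a, b, c⟩
    exact ⟨(exists_perm_iff_of_conj _ hconj).1 a, by rw [hr, b], (prod_shiftPerm g).2 c⟩
  · rintro ⟨a, b, c⟩
    exact ⟨(exists_perm_iff_of_conj _ hconj).2 a, by rw [← hr, b], (prod_shiftPerm g).1 c⟩

/-- Inner equivalence: simultaneous conjugation by an element of `H`. -/
def innerSetoid (φ : H →* G) (C : Fin r → ConjClasses G) : Setoid (Nielsen φ C) where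
  r g g' := ∃ h : H, ∀ i, g'.1 i = h * g.1 i * h⁻¹
  iseqv :=
    { refl := fun _ => ⟨1, by simp⟩
      symm := by
        rintro g g' ⟨h, hh⟩
        exact ⟨h⁻¹, fun i => by rw [hh]; group⟩
      trans := by
        rintro g g' g'' ⟨h, hh⟩ ⟨k, hk⟩
        exact ⟨k * h, fun i => by rw [hk, hh]; group⟩ }

/-- The inner Nielsen class `Ni(H, C)^in = Ni(H, C) / H`. -/
def InnerNielsen (φ : H →* G) (C : Fin r → ConjClasses G) : Type _ :=
  Quotient (innerSetoid φ C)

/-- The braid generator `q_{i+1}` acting on the inner Nielsen class (`i` counts from `0`). -/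
def braidGen (φ : H →* G) (C : Fin r → ConjClasses G) (i : ℕ) (hi : i + 1 < r) :
    Equiv.Perm (InnerNielsen φ C) :=
  Quotient.congr ((braidPerm (i := ⟨i, by omega⟩) (j := ⟨i + 1, hi⟩) (by simp)).subtypeEquiv
    (isNielsen_braidPerm i hi)) (by
      rintro ⟨g, hg⟩ ⟨g', hg'⟩
      constructor
      · rintro ⟨h, hh⟩
        refine ⟨h, fun k => ?_⟩
        simp only [Equiv.subtypeEquiv_apply, braidPerm, Equiv.coe_fn_mk, braidFun] at hh ⊢
        simp only [hh]
        split_ifs <;> group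
      · rintro ⟨h, hh⟩
        refine ⟨h, fun k => ?_⟩
        have e : ∀ x : Fin r → H, x = braidInvFun ⟨i, by omega⟩ ⟨i + 1, hi⟩
            (braidFun ⟨i, by omega⟩ ⟨i + 1, hi⟩ x) := fun x =>
          ((braidPerm (H := H) (i := ⟨i, by omega⟩) (j := ⟨i + 1, hi⟩)
            (by simp)).symm_apply_apply x).symm
        change ∀ k, braidFun ⟨i, by omega⟩ ⟨i + 1, hi⟩ g' k =
          h * braidFun ⟨i, by omega⟩ ⟨i + 1, hi⟩ g k * h⁻¹ at hh
        change g' k = h * g k * h⁻¹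
        rw [e g', e g]
        generalize braidFun ⟨i, by omega⟩ ⟨i + 1, hi⟩ g' = y' at hh ⊢
        generalize braidFun ⟨i, by omega⟩ ⟨i + 1, hi⟩ g = y at hh ⊢
        simp only [braidInvFun, hh]
        split_ifs <;> group)

/-- The shift `sh` acting on the inner Nielsen class. -/
def shiftGen (φ : H →* G) (C : Fin r → ConjClasses G) : Equiv.Perm (InnerNielsen φ C) :=
  Quotient.congr (shiftPerm.subtypeEquiv isNielsen_shiftPerm) (by
    rintro ⟨g, hg⟩ ⟨g', hg'⟩
    constructor
    · rintro ⟨h, hh⟩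
      exact ⟨h, fun k => hh (finRotate r k)⟩
    · rintro ⟨h, hh⟩
      refine ⟨h, fun k => ?_⟩
      have hk := hh ((finRotate r).symm k)
      change g' (finRotate r ((finRotate r).symm k)) =
        h * g (finRotate r ((finRotate r).symm k)) * h⁻¹ at hk
      rwa [Equiv.apply_symm_apply] at hk)

/-- The group of permutations of `Ni(H, C)^in` through which the Hurwitz monodromy group `H_r`
acts: it is generated by `q_1, …, q_{r-1}` and `sh`. -/
def hurwitzGroup (φ : H →* G) (C : Fin r → ConjClasses G) :
    Subgroup (Equiv.Perm (InnerNielsen φ C)) :=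
  Subgroup.closure ({q | ∃ i, ∃ hi : i + 1 < r, q = braidGen φ C i hi} ∪ {shiftGen φ C})

/-- Braid orbits on `Ni(H, C)^in`; they correspond to the (absolutely irreducible) components of
the Hurwitz space `ℋ(H, C)^in`. -/
def IsBraidOrbit (φ : H →* G) (C : Fin r → ConjClasses G) (O : Set (InnerNielsen φ C)) : Prop :=
  ∃ x, O = MulAction.orbit (hurwitzGroup φ C) x

theorem IsNielsen.map {φ : H →* G} {φ' : H' →* G} {C : Fin r → ConjClasses G} {f : H' →* H}
    (hf : Function.Surjective f) (hφ : φ.comp f = φ') {g : Fin r → H'} (hg : IsNielsen φ' C g) :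
    IsNielsen φ C (f ∘ g) := by
  subst hφ
  obtain ⟨⟨σ, hσ⟩, b, c⟩ := hg
  refine ⟨⟨σ, fun i => ⟨(hσ i).1, ?_⟩⟩, ?_, ?_⟩
  · apply Nat.dvd_antisymm
    · have h := (hσ i).2
      rw [MonoidHom.comp_apply] at h
      exact h ▸ orderOf_map_dvd f (g i)
    · exact orderOf_map_dvd φ (f (g i))
  · rw [Set.range_comp, ← MonoidHom.map_closure, b, Subgroup.map_top_of_surjective f hf]
  · rw [← List.map_ofFn, ← map_list_prod, c, map_one]

/-- The map `Ni(H', C)^in → Ni(H, C)^in` induced by a cover `f : H' → H` over `G`. -/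
def innerMap {φ : H →* G} {φ' : H' →* G} (C : Fin r → ConjClasses G) (f : H' →* H)
    (hf : Function.Surjective f) (hφ : φ.comp f = φ') : InnerNielsen φ' C → InnerNielsen φ C :=
  Quotient.map (sa := innerSetoid φ' C) (sb := innerSetoid φ C)
    (fun g => ⟨f ∘ g.1, g.2.map hf hφ⟩) (by
      rintro g g' ⟨h, hh⟩
      exact ⟨f h, fun i => by simp [hh]⟩)

end Nielsen

/-! ### Modular towers -/

section Towers

variable {A G : Type*} [Group A] [TopologicalSpace A] [IsTopologicalGroup A]
  [Group G] [TopologicalSpace G] [T1Space G] {r : ℕ}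

/-- The inner Nielsen class `Ni(A / ker_k, C)^in` of level `k` of the cover `ψ : A → G`. The level
`k` Hurwitz space is the covering of the space of `r`-element subsets of the Riemann sphere that
has this set as its fibre, with monodromy the braid action. -/
abbrev TowerLevel (ℓ : ℕ) (ψ : A →ₜ* G) (C : Fin r → ConjClasses G) (k : ℕ) : Type _ :=
  InnerNielsen (levelToBase ℓ ψ k) C

/-- The natural map from level `k + 1` to level `k`. -/
def towerMap (ℓ : ℕ) (ψ : A →ₜ* G) (C : Fin r → ConjClasses G) (k : ℕ) :
    TowerLevel ℓ ψ C (k + 1) → TowerLevel ℓ ψ C k :=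
  innerMap C (levelMap ℓ ψ k) (levelMap_surjective ℓ ψ k) (levelToBase_comp_levelMap ℓ ψ k)

/-- A modular tower on the cover `ψ : A → G`: a braid orbit `O k` on each level, such that the
natural map from level `k + 1` to level `k` maps `O (k + 1)` onto `O k`. -/
structure IsModularTower (ℓ : ℕ) (ψ : A →ₜ* G) (C : Fin r → ConjClasses G)
    (O : ∀ k, Set (TowerLevel ℓ ψ C k)) : Prop where
  orbit : ∀ k, IsBraidOrbit (levelToBase ℓ ψ k) C (O k)
  compat : ∀ k, towerMap ℓ ψ C k '' O (k + 1) = O k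

end Towers

end ModularTower

namespace ModularTower

open CategoryTheory
open scoped commutatorElement

/-! This is a compactness argument: if every level is finite and nonempty, König's lemma
(`exists_compatible_sequence`) yields points `x k` of the inner Nielsen classes with `x (k + 1)`
over `x k`, and their braid orbits form the tower.

Two things must be supplied. Finiteness (`finite_level`): a nonempty Nielsen class provides finitely
many generators of the level group. Level `0` embeds in the finite group `G`. If level `k` is
finite, the kernel of level `k + 1` over level `k` has finite index in a finitely generated group,
so it is finitely generated by Schreier's lemma. It is also abelian of exponent dividing `ℓ`, hence
finite. Thus nonemptiness of the levels gives their finiteness as well.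

Orbits (`image_innerMap_orbit`): the maps between levels commute with each `q_i` and with `sh`, so
the image of the orbit of a point is the whole orbit of its image. Compatible points therefore have
compatible orbits, with surjectivity included. -/

/-- König's lemma for a sequence of nonempty finite types. -/
theorem exists_compatible_sequence {X : ℕ → Type*} [∀ k, Finite (X k)] [∀ k, Nonempty (X k)]
    (f : ∀ k, X (k + 1) → X k) : ∃ x : ∀ k, X k, ∀ k, f k (x (k + 1)) = x k := by
  -- A compatible sequence is a section of the inverse system over `ℕᵒᵖ`; compatibility is read off
  -- on the arrows `k ≤ k + 1`.
  let F : ℕᵒᵖ ⥤ Type _ := Functor.ofOpSequence (X := X) fun k => ↾(f k)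
  have : ∀ j, Finite (F.obj j) := fun j => inferInstanceAs (Finite (X j.unop))
  have : ∀ j, Nonempty (F.obj j) := fun j => inferInstanceAs (Nonempty (X j.unop))
  obtain ⟨u, hu⟩ := nonempty_sections_of_finite_inverse_system F
  refine ⟨fun k => u (Opposite.op k), fun k => ?_⟩
  have h := hu (homOfLE (Nat.le_succ k)).op
  rw [Functor.ofOpSequence_map_homOfLE_succ] at h
  exact h

/-- A finitely generated extension of a finite group by an abelian group of finite exponent is
finite. -/
theorem finite_of_fg_of_ker {E Q : Type*} [Group E] [Group Q] [Finite Q] [Group.FG E]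
    (f : E →* Q) {n : ℕ} (hn : 0 < n) (hpow : ∀ x ∈ f.ker, x ^ n = 1)
    (hcomm : ∀ x ∈ f.ker, ∀ y ∈ f.ker, x * y = y * x) : Finite E := by
  have : f.ker.FiniteIndex := inferInstance
  -- Schreier's lemma: a finite-index subgroup of a finitely generated group is finitely generated.
  have : Group.FG f.ker := inferInstance
  let _ : CommGroup f.ker :=
    { (inferInstance : Group f.ker) with
      mul_comm := fun x y => Subtype.ext (hcomm x x.2 y y.2) }
  have : Finite f.ker := CommGroup.finite_of_fg_isMulTorsion f.ker fun x =>
    isOfFinOrder_iff_pow_eq_one.2 ⟨n, hn, Subtype.ext (hpow x x.2)⟩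
  have : Finite (E ⧸ f.ker) := inferInstance
  exact Finite.of_subgroup_quotient f.ker

/-! ### Orbits under an equivariant map -/

section Orbits

variable {X Y : Type*}

/-- If a map intertwines two families of permutations, it maps the orbits of the group generated
by the first family onto the orbits of the group generated by the second. -/
theorem image_orbit_closure {ι : Type*} (f : X → Y) (s : ι → Equiv.Perm X)
    (t : ι → Equiv.Perm Y) (h : ∀ i x, f (s i x) = t i (f x)) (x : X) :
    f '' MulAction.orbit (Subgroup.closure (Set.range s)) x =
      MulAction.orbit (Subgroup.closure (Set.range t)) (f x) := by
  -- The two permutation groups are compared through the free group on the common index set: one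
  -- word acts on both sides, so no homomorphism between the two groups is needed.
  let F : FreeGroup ι →* Equiv.Perm X := FreeGroup.lift s
  let F' : FreeGroup ι →* Equiv.Perm Y := FreeGroup.lift t
  have key : ∀ w : FreeGroup ι, ∀ z, f (F w z) = F' w (f z) := by
    intro w
    induction w using FreeGroup.induction_on with
    | C1 => simp
    | of i => intro z; simpa [F, F'] using h i z
    | inv_of i _ =>
      intro z
      -- Equivariance for an inverse generator is equivariance for the generator at the preimage of
      -- `z`.
      have := h i ((s i)⁻¹ z)
      simp only [Equiv.Perm.inv_def, Equiv.apply_symm_apply] at this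
      simp [F, F', this]
    | mul v w hv hw => intro z; simp [hv, hw]
  rw [← FreeGroup.range_lift_eq_closure, ← FreeGroup.range_lift_eq_closure]
  ext y
  constructor
  · rintro ⟨_, ⟨⟨_, w, rfl⟩, rfl⟩, rfl⟩
    exact ⟨⟨F' w, w, rfl⟩, (key w x).symm⟩
  · rintro ⟨⟨_, w, rfl⟩, rfl⟩
    exact ⟨_, ⟨⟨F w, w, rfl⟩, rfl⟩, key w x⟩

end Orbits

/-! ### Braid equivariance and finiteness of Nielsen classes -/

section Equivariance

variable {H H' G : Type*} [Group H] [Group H'] [Group G] {r : ℕ}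

/-- The generators `q_1, …, q_{r-1}` and `sh` of the Hurwitz monodromy group, as a family. -/
def hurwitzGen (φ : H →* G) (C : Fin r → ConjClasses G) :
    Option {i : ℕ // i + 1 < r} → Equiv.Perm (InnerNielsen φ C)
  | none => shiftGen φ C
  | some i => braidGen φ C i.1 i.2

/-- The index set depends only on `r`, so the generators at different levels are matched by index,
as `image_orbit_closure` requires. -/
theorem hurwitzGroup_eq_closure_range (φ : H →* G) (C : Fin r → ConjClasses G) :
    hurwitzGroup φ C = Subgroup.closure (Set.range (hurwitzGen φ C)) := by
  unfold hurwitzGroup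
  congr 1
  ext q
  constructor
  · rintro (⟨i, hi, rfl⟩ | rfl)
    · exact ⟨some ⟨i, hi⟩, rfl⟩
    · exact ⟨none, rfl⟩
  · rintro ⟨_ | i, rfl⟩
    · exact Or.inr rfl
    · exact Or.inl ⟨i.1, i.2, rfl⟩

theorem map_braidFun (f : H' →* H) (i j : Fin r) (g : Fin r → H') :
    f ∘ braidFun i j g = braidFun i j (f ∘ g) := by
  funext k
  simp only [Function.comp_apply, braidFun]
  split_ifs <;> simp

/-- On representatives, `sh` only permutes the entries and `q_i` is given by group words in them; a
homomorphism applied entrywise respects both. -/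
theorem innerMap_hurwitzGen {φ : H →* G} {φ' : H' →* G} (C : Fin r → ConjClasses G) (f : H' →* H)
    (hf : Function.Surjective f) (hφ : φ.comp f = φ') (i : Option {i : ℕ // i + 1 < r})
    (x : InnerNielsen φ' C) :
    innerMap C f hf hφ (hurwitzGen φ' C i x) = hurwitzGen φ C i (innerMap C f hf hφ x) := by
  induction x using Quotient.inductionOn with
  | h g =>
    cases i with
    | none => rfl
    | some i => exact congrArg (Quotient.mk _) (Subtype.ext (map_braidFun f _ _ g.1))

/-- The map of inner Nielsen classes induced by a cover maps braid orbits onto braid orbits. -/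
theorem image_innerMap_orbit {φ : H →* G} {φ' : H' →* G} (C : Fin r → ConjClasses G)
    (f : H' →* H) (hf : Function.Surjective f) (hφ : φ.comp f = φ') (x : InnerNielsen φ' C) :
    innerMap C f hf hφ '' MulAction.orbit (hurwitzGroup φ' C) x =
      MulAction.orbit (hurwitzGroup φ C) (innerMap C f hf hφ x) := by
  rw [hurwitzGroup_eq_closure_range, hurwitzGroup_eq_closure_range]
  exact image_orbit_closure _ _ _ (innerMap_hurwitzGen C f hf hφ) x

/-- A group with a nonempty Nielsen class is finitely generated. -/
theorem group_fg_of_nonempty_innerNielsen {φ : H →* G} {C : Fin r → ConjClasses G}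
    (h : Nonempty (InnerNielsen φ C)) : Group.FG H := by
  obtain ⟨x⟩ := h
  induction x using Quotient.inductionOn with
  | h g => exact Group.fg_iff.2 ⟨_, g.2.generates, Set.finite_range _⟩

instance [Finite H] (φ : H →* G) (C : Fin r → ConjClasses G) : Finite (InnerNielsen φ C) :=
  inferInstanceAs (Finite (Quotient (innerSetoid φ C)))

end Equivariance

/-! ### Finiteness of the levels and the modular tower -/

section Levels

variable {A G : Type*} [Group A] [TopologicalSpace A] [IsTopologicalGroup A]
  [Group G] [TopologicalSpace G]

/-- Together with `commutator_mem_charKer_succ`, this makes the kernel of `levelMap` abelian of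
exponent dividing `ℓ`. -/
theorem pow_mem_charKer_succ (ℓ : ℕ) (ψ : A →ₜ* G) {k : ℕ} {x : A} (hx : x ∈ charKer ℓ ψ k) :
    x ^ ℓ ∈ charKer ℓ ψ (k + 1) :=
  Subgroup.le_topologicalClosure _ (Subgroup.mem_sup_left (Subgroup.subset_closure ⟨x, hx, rfl⟩))

theorem commutator_mem_charKer_succ (ℓ : ℕ) (ψ : A →ₜ* G) {k : ℕ} {x y : A}
    (hx : x ∈ charKer ℓ ψ k) (hy : y ∈ charKer ℓ ψ k) : ⁅x, y⁆ ∈ charKer ℓ ψ (k + 1) :=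
  Subgroup.le_topologicalClosure _
    (Subgroup.mem_sup_right (Subgroup.commutator_mem_commutator hx hy))

/-- If all levels of a cover of a finite group are finitely generated, they are finite. -/
theorem finite_level [T1Space G] [Finite G] {ℓ : ℕ} (hℓ : 0 < ℓ) (ψ : A →ₜ* G)
    (hfg : ∀ k, Group.FG (Level ℓ ψ k)) (k : ℕ) : Finite (Level ℓ ψ k) := by
  induction k with
  | zero => exact Finite.of_injective _ (QuotientGroup.kerLift_injective ψ.toMonoidHom)
  | succ k ih =>
    have := hfg (k + 1)
    -- The kernel is `ker_k / ker_{k+1}`, so its elements have representatives in `ker_k`.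
    have hker : ∀ x ∈ (levelMap ℓ ψ k).ker, ∃ a ∈ charKer ℓ ψ k, QuotientGroup.mk a = x := by
      intro x hx
      obtain ⟨a, rfl⟩ := QuotientGroup.mk_surjective x
      exact ⟨a, (QuotientGroup.eq_one_iff (N := charKer ℓ ψ k) a).1 hx, rfl⟩
    refine finite_of_fg_of_ker (levelMap ℓ ψ k) hℓ (fun x hx => ?_) (fun x hx y hy => ?_)
    · obtain ⟨a, ha, rfl⟩ := hker x hx
      exact (QuotientGroup.eq_one_iff (N := charKer ℓ ψ (k + 1)) _).2
        (pow_mem_charKer_succ ℓ ψ ha)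
    · obtain ⟨a, ha, rfl⟩ := hker x hx
      obtain ⟨b, hb, rfl⟩ := hker y hy
      rw [← commutatorElement_eq_one_iff_mul_comm]
      exact (QuotientGroup.eq_one_iff (N := charKer ℓ ψ (k + 1)) _).2
        (commutator_mem_charKer_succ ℓ ψ ha hb)

/-- A tower of nonempty inner Nielsen classes over a finite group carries a modular tower. -/
theorem exists_isModularTower [T1Space G] [Finite G] {ℓ r : ℕ} (hℓ : 0 < ℓ) (ψ : A →ₜ* G)
    (C : Fin r → ConjClasses G) (hne : ∀ k, Nonempty (TowerLevel ℓ ψ C k)) :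
    ∃ O : ∀ k, Set (TowerLevel ℓ ψ C k), IsModularTower ℓ ψ C O := by
  have := finite_level hℓ ψ fun k => group_fg_of_nonempty_innerNielsen (hne k)
  obtain ⟨x, hx⟩ := exists_compatible_sequence (towerMap ℓ ψ C)
  refine ⟨fun k => MulAction.orbit (hurwitzGroup (levelToBase ℓ ψ k) C) (x k),
    fun k => ⟨x k, rfl⟩, fun k => ?_⟩
  -- The base point at level `k` is replaced by the image of the one at level `k + 1`, so that the
  -- claim becomes equivariance of orbits.
  rw [← hx k]
  exact image_innerMap_orbit C _ _ _ _

end Levels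

end ModularTower

theorem mainTheorem7 {G : Type*} [Group G] [Finite G] [TopologicalSpace G] [DiscreteTopology G]
    (ℓ : ℕ) (hℓ : ℓ.Prime) (hdvd : ℓ ∣ Nat.card G) (hperf : ModularTower.IsLPerfect ℓ G)
    {r : ℕ} (C : Fin r → ConjClasses G)
    (hC : ∀ i, ∀ x ∈ (C i).carrier, (orderOf x).Coprime ℓ)
    {Gt : Type*} [Group Gt] [TopologicalSpace Gt] [IsTopologicalGroup Gt] [CompactSpace Gt]
    [T2Space Gt] [TotallyDisconnectedSpace Gt] (ψ : Gt →ₜ* G)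
    (hψ : ModularTower.IsUniversalLFrattiniCover ℓ ψ)
    (hne : ∀ k, Nonempty (ModularTower.TowerLevel ℓ (ModularTower.abCoverMap ψ) C k)) :
    ∃ O : ∀ k, Set (ModularTower.TowerLevel ℓ (ModularTower.abCoverMap ψ) C k),
      ModularTower.IsModularTower ℓ (ModularTower.abCoverMap ψ) C O := by
  exact ModularTower.exists_isModularTower hℓ.pos _ C hne
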